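/- **Proposition 3.1 ($L^p_{\rm loc}$ estimate).** Write points of $\mathbb R^3$ in cylindrical coordinates $(r,\theta,z)$, with $r=\sqrt{x_1^2+x_2^2}$, $e_r=(\cos\theta,\sin\theta,0)$, $e_\theta=(-\sin\theta,\cos\theta,0)$, $e_z=(0,0,1)$. For every $R>0$ there is a constant $C_R>0$, depending only on $R$, such that the following holds for every $p\in(1,\infty)$. Let $u:\mathbb R^3\to\mathbb R^3$ be a $C^\infty$ axisymmetric vector field without swirl, i.e. $u=u_r(r,z)\,e_r+u_z(r,z)\,e_z$, such that $\nabla\cdot u=0$ and $u$ vanishes at infinity in the mean, i.e. $$\lim_{\rho\to\infty}\ \rho^{-3}\int_{|x|<\rho}|u(x)|\,dx=0 .$$ Let $w^\theta=(\nabla\times u)\cdot e_\theta=\partial_z u_r-\partial_r u_z$. Then $$\|u\|_{L^p(B_R\times[-R,R])}\le C_R\,\Big\|\frac{w^\theta}{r}\Big\|_{L^1\cap L^p(\mathbb R^3)},$$ where $B_R\subset\mathbb R^2$ is the disc of radius $R$ centred at $0$ and $\|f\|_{L^1\cap L^p}=\|f\|_{L^1}+\|f\|_{L^p}$ (the right-hand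 side being $+\infty$ if $w^\theta/r\notin L^1\cap L^p(\mathbb R^3)$). -/

import Mathlib

open MeasureTheory Filter
open scoped ENNReal NNReal Topology ContDiff

noncomputable section

/-- Three-dimensional space with its Euclidean norm; the coordinates of `x` are `x 0, x 1, x 2`. -/
abbrev Space3 : Type := EuclideanSpace ℝ (Fin 3)

/-- The partial derivative `∂_j u_i` at `x`. -/
def partialD (u : Space3 → Space3) (j i : Fin 3) (x : Space3) : ℝ :=
  (fderiv ℝ u x (EuclideanSpace.single j 1)) i

/-- The divergence `∇ · u`. -/
def divg (u : Space3 → Space3) (x : Space3) : ℝ :=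
  ∑ i, partialD u i i x

/-- The vorticity `∇ × u`. -/
def vorticity (u : Space3 → Space3) (x : Space3) : Space3 :=
  !₂[partialD u 1 2 x - partialD u 2 1 x,
     partialD u 2 0 x - partialD u 0 2 x,
     partialD u 0 1 x - partialD u 1 0 x]

/-- The point with cylindrical coordinates `(r, θ, z)`. -/
def cylPoint (r θ z : ℝ) : Space3 := !₂[r * Real.cos θ, r * Real.sin θ, z]

/-- The radial unit vector `e_r` at angle `θ`. -/
def eRad (θ : ℝ) : Space3 := !₂[Real.cos θ, Real.sin θ, 0]

/-- The azimuthal unit vector `e_θ` at angle `θ`. -/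
def eAng (θ : ℝ) : Space3 := !₂[-Real.sin θ, Real.cos θ, 0]

/-- The vertical unit vector `e_z`. -/
def eVert : Space3 := !₂[0, 0, 1]

/-- `u = u_r(r,z) e_r + u_θ(r,z) e_θ + u_z(r,z) e_z` in cylindrical coordinates. -/
def HasCylComponents (u : Space3 → Space3) (ur uθ uz : ℝ → ℝ → ℝ) : Prop :=
  ∀ r θ z : ℝ, 0 ≤ r →
    u (cylPoint r θ z) = ur r z • eRad θ + uθ r z • eAng θ + uz r z • eVert

/-- Axisymmetric vector fields whose swirl component `u_θ` vanishes identically. -/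
def IsAxisymmetricNoSwirl (u : Space3 → Space3) : Prop :=
  ∃ ur uz : ℝ → ℝ → ℝ, HasCylComponents u ur (fun _ _ => 0) uz

/-- The distance `r` to the axis of symmetry. -/
def axisDist (x : Space3) : ℝ := Real.sqrt (x 0 ^ 2 + x 1 ^ 2)

/-- The field `e_θ = (-x₁, x₀, 0) / r` on space (with the value `0` on the axis, a null set). -/
def eAngField (x : Space3) : Space3 := (axisDist x)⁻¹ • !₂[-x 1, x 0, 0]

/-- The azimuthal component `w^θ = (∇ × u) · e_θ` of the vorticity. -/
def vortAng (u : Space3 → Space3) (x : Space3) : ℝ :=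
  inner ℝ (vorticity u x) (eAngField x)

/-- The quotient `w^θ / r` (with the value `0` on the axis, a null set). -/
def vortAngDivR (u : Space3 → Space3) (x : Space3) : ℝ :=
  vortAng u x / axisDist x

/-- The cylinder `B_R × [-R, R]`, where `B_R` is the disc of radius `R` about `0` in the plane. -/
def solidCylinder (R : ℝ) : Set Space3 :=
  {x | axisDist x < R ∧ x 2 ∈ Set.Icc (-R) R}

/-- `u` vanishes at infinity in the mean: `ρ⁻³ ∫_{|x| < ρ} |u| dx → 0` as `ρ → ∞`. -/
def VanishesInMean (u : Space3 → Space3) : Prop :=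
  Tendsto (fun ρ : ℝ => (ρ ^ 3)⁻¹ * ∫ x in Metric.ball (0 : Space3) ρ, ‖u x‖) atTop (𝓝 0)

/-- The norm of `L¹ ∩ L^p`, the sum of the two norms; it is `∞` outside the space. -/
def normL1Lp (f : Space3 → ℝ) (p : ℝ≥0∞) : ℝ≥0∞ :=
  eLpNorm f 1 volume + eLpNorm f p volume

end

/-! A divergence-free field that vanishes at infinity in the mean satisfies the Biot–Savart bound
`|u(x)| ≤ C ∫ |∇ × u|(y) |y - x|⁻² dy`. To prove it without convergence questions, the Newtonian
field `y / |y|³` is replaced by the difference `K` of the fields of the same charge smeared over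
balls of radii `ε ≤ ρ`. This `K` is C¹, compactly supported and curl-free, is bounded by a multiple
of `|y|⁻²` uniformly in `ε` and `ρ`, and has divergence `q_ε - q_ρ`, the difference of the charge
densities. Two integrations by parts turn `∫ u_i (q_ε - q_ρ)` into an integral of `∇ × u` against
`K` (`integral_component_mul_smearedCharge_sub`). Decay in the mean removes `q_ρ` as `ρ → ∞`, and `ε
→ 0` recovers the value of `u` at the centre (`enorm_le_lintegral_vorticity`).

Without swirl the vorticity is azimuthal, so `|∇ × u| = r |w^θ / r|` off the axis
(`norm_vorticity_le` gives `≤`). For `x` in the cylinder the weighted kernel `r |y - x|⁻²` is at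
most a constant plus an integrable truncated kernel (`axisDist_mul_newtonKernel_le`). The constant
pairs with the `L¹` norm, the truncated kernel with the `L^p` norm through Young's inequality. -/

/-! ### Radial profile of the smeared Newtonian field -/

/-- The derivative of `kernelProfile`. -/
noncomputable def kernelProfileDeriv (s : ℝ) : ℝ := -(3 / 2) * (max s 1) ^ (-(5 / 2) : ℝ)

/-- A `C¹` function equal to `s ^ (-3/2)` for `s ≥ 1` and affine for `s ≤ 1`. -/
noncomputable def kernelProfile (s : ℝ) : ℝ := 1 + ∫ t in (1 : ℝ)..s, kernelProfileDeriv t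

lemma continuous_kernelProfileDeriv : Continuous kernelProfileDeriv := by
  unfold kernelProfileDeriv
  refine continuous_const.mul (Continuous.rpow_const (by fun_prop) fun s => Or.inl ?_)
  have : (1 : ℝ) ≤ max s 1 := le_max_right _ _
  positivity

lemma hasDerivAt_kernelProfile (s : ℝ) :
    HasDerivAt kernelProfile (kernelProfileDeriv s) s := by
  have := intervalIntegral.integral_hasDerivAt_right
    (continuous_kernelProfileDeriv.intervalIntegrable 1 s)
    (continuous_kernelProfileDeriv.stronglyMeasurableAtFilter _ _)
    continuous_kernelProfileDeriv.continuousAt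
  exact this.const_add 1

/-- The affine branch is the tangent to `s ^ (-3/2)` at `s = 1`. One continuous derivative is enough
for the integrations by parts. -/
lemma contDiff_kernelProfile : ContDiff ℝ 1 kernelProfile := by
  rw [contDiff_one_iff_deriv]
  refine ⟨fun s => (hasDerivAt_kernelProfile s).differentiableAt, ?_⟩
  have : deriv kernelProfile = kernelProfileDeriv :=
    funext fun s => (hasDerivAt_kernelProfile s).deriv
  rw [this]
  exact continuous_kernelProfileDeriv

lemma kernelProfileDeriv_of_le {s : ℝ} (hs : s ≤ 1) : kernelProfileDeriv s = -(3 / 2) := by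
  simp [kernelProfileDeriv, max_eq_right hs]

lemma kernelProfile_of_le {s : ℝ} (hs : s ≤ 1) : kernelProfile s = 5 / 2 - 3 / 2 * s := by
  have : ∫ t in (1 : ℝ)..s, kernelProfileDeriv t = ∫ t in (1 : ℝ)..s, (-(3 / 2) : ℝ) := by
    refine intervalIntegral.integral_congr fun t ht => ?_
    rw [Set.uIcc_of_ge hs] at ht
    exact kernelProfileDeriv_of_le ht.2
  rw [kernelProfile, this, intervalIntegral.integral_const, smul_eq_mul]
  ring

lemma kernelProfile_of_ge {s : ℝ} (hs : 1 ≤ s) : kernelProfile s = s ^ (-(3 / 2) : ℝ) := by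
  have : ∫ t in (1 : ℝ)..s, kernelProfileDeriv t
      = ∫ t in (1 : ℝ)..s, -(3 / 2) * t ^ (-(5 / 2) : ℝ) := by
    refine intervalIntegral.integral_congr fun t ht => ?_
    rw [Set.uIcc_of_le hs] at ht
    simp [kernelProfileDeriv, max_eq_left ht.1]
  rw [kernelProfile, this, intervalIntegral.integral_const_mul, integral_rpow]
  · norm_num
    ring
  · right
    refine ⟨by norm_num, ?_⟩
    rw [Set.uIcc_of_le hs]
    exact fun h => by linarith [h.1]

/-- The charge density `3 p + 2 s p'` of the profile `p`. -/
noncomputable def chargeProfile (s : ℝ) : ℝ := 15 / 2 * max 0 (1 - s)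

/-- With `s = |y|²`, the left side is the divergence of `p(|y|²) y`. It vanishes for `s ≥ 1` because
`y / |y|³` is divergence-free away from `0`. -/
lemma chargeProfile_eq {s : ℝ} :
    3 * kernelProfile s + 2 * s * kernelProfileDeriv s = chargeProfile s := by
  rcases le_total s 1 with hs | hs
  · rw [kernelProfile_of_le hs, kernelProfileDeriv_of_le hs, chargeProfile,
      max_eq_right (by linarith)]
    ring
  · rw [kernelProfile_of_ge hs, kernelProfileDeriv, max_eq_left hs, chargeProfile,
      max_eq_left (by linarith)]
    have : s ^ (-(3 / 2) : ℝ) = s * s ^ (-(5 / 2) : ℝ) := by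
      have hs0 : 0 < s := by linarith
      nth_rw 2 [← Real.rpow_one s]
      rw [← Real.rpow_add hs0]
      norm_num
    rw [this]
    ring

lemma rpow_neg_three_halves_sq {t : ℝ} (ht : 0 ≤ t) : (t ^ 2) ^ (-(3 / 2) : ℝ) = (t ^ 3)⁻¹ := by
  rw [← Real.rpow_natCast t 2, ← Real.rpow_mul ht, ← Real.rpow_natCast t 3, ← Real.rpow_neg ht]
  norm_num

lemma kernelProfile_nonneg (s : ℝ) : 0 ≤ kernelProfile s := by
  rcases le_total s 1 with hs | hs
  · rw [kernelProfile_of_le hs]; linarith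
  · rw [kernelProfile_of_ge hs]; positivity

lemma kernelProfile_sq_le {t : ℝ} (ht : 0 < t) : kernelProfile (t ^ 2) ≤ 5 / 2 * (t ^ 3)⁻¹ := by
  rcases le_total t 1 with hs | hs
  · rw [kernelProfile_of_le (by nlinarith)]
    have : 1 ≤ (t ^ 3)⁻¹ := (one_le_inv₀ (by positivity)).2 (pow_le_one₀ ht.le hs)
    nlinarith [sq_nonneg t]
  · rw [kernelProfile_of_ge (by nlinarith), rpow_neg_three_halves_sq ht.le]
    have : 0 ≤ (t ^ 3)⁻¹ := by positivity
    linarith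

/-! ### Smeared Newtonian fields: support, curl, divergence, size -/

/-- The factor of `y` in the Newtonian field of a charge smeared over the ball of radius `ε`. -/
noncomputable def smearedFactor (ε : ℝ) (y : Space3) : ℝ :=
  (ε ^ 3)⁻¹ * kernelProfile (‖y‖ ^ 2 / ε ^ 2)

/-- The charge density smeared over the ball of radius `ε`. -/
noncomputable def smearedCharge (ε : ℝ) (y : Space3) : ℝ :=
  (ε ^ 3)⁻¹ * chargeProfile (‖y‖ ^ 2 / ε ^ 2)

lemma smearedFactor_nonneg {ε : ℝ} (hε : 0 < ε) (y : Space3) : 0 ≤ smearedFactor ε y :=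
  mul_nonneg (by positivity) (kernelProfile_nonneg _)

lemma smearedFactor_le {ε : ℝ} (hε : 0 < ε) {y : Space3} (hy : y ≠ 0) :
    smearedFactor ε y ≤ 5 / 2 * (‖y‖ ^ 3)⁻¹ := by
  have hy' : 0 < ‖y‖ := norm_pos_iff.2 hy
  have := kernelProfile_sq_le (t := ‖y‖ / ε) (by positivity)
  rw [div_pow] at this
  calc smearedFactor ε y ≤ (ε ^ 3)⁻¹ * (5 / 2 * ((‖y‖ / ε) ^ 3)⁻¹) := by
        unfold smearedFactor; gcongr
    _ = _ := by field_simp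

lemma smearedFactor_of_le {ε : ℝ} (hε : 0 < ε) {y : Space3} (hy : ε ≤ ‖y‖) :
    smearedFactor ε y = (‖y‖ ^ 3)⁻¹ := by
  have hy' : 0 < ‖y‖ := hε.trans_le hy
  have h1 : 1 ≤ ‖y‖ / ε := (one_le_div hε).2 hy
  rw [smearedFactor, ← div_pow, kernelProfile_of_ge (one_le_pow₀ h1),
    rpow_neg_three_halves_sq (by positivity)]
  field_simp

lemma contDiff_smearedFactor (ε : ℝ) : ContDiff ℝ 1 (smearedFactor ε) := by
  unfold smearedFactor
  exact contDiff_const.mul (contDiff_kernelProfile.comp ((contDiff_norm_sq ℝ).div_const _))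

lemma hasFDerivAt_smearedFactor (ε : ℝ) (y : Space3) :
    HasFDerivAt (smearedFactor ε)
      ((2 * (ε ^ 3)⁻¹ * (kernelProfileDeriv (‖y‖ ^ 2 / ε ^ 2) / ε ^ 2)) • innerSL ℝ y) y := by
  have h1 : HasFDerivAt (fun y : Space3 => ‖y‖ ^ 2) (2 • innerSL ℝ y) y :=
    (hasStrictFDerivAt_norm_sq y).hasFDerivAt
  have h2 := (hasDerivAt_kernelProfile (‖y‖ ^ 2 / ε ^ 2)).comp_hasFDerivAt y
    (h1.mul_const (ε ^ 2)⁻¹)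
  have h3 := h2.const_mul ((ε ^ 3)⁻¹)
  refine h3.congr_fderiv ?_
  ext z
  simp
  ring

/-- The Newtonian potential field of the difference of two smeared unit charges. -/
noncomputable def smearedField (ε ρ : ℝ) (i : Fin 3) (y : Space3) : ℝ :=
  (smearedFactor ε y - smearedFactor ρ y) * y i

lemma contDiff_smearedField (ε ρ : ℝ) (i : Fin 3) : ContDiff ℝ 1 (smearedField ε ρ i) := by
  unfold smearedField
  refine ((contDiff_smearedFactor ε).sub (contDiff_smearedFactor ρ)).mul ?_
  exact (EuclideanSpace.proj (𝕜 := ℝ) i : Space3 →L[ℝ] ℝ).contDiff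

/-- Outside the ball of radius `ρ` both charges act as the same point charge, so their fields
cancel. -/
lemma hasCompactSupport_smearedField {ε ρ : ℝ} (hε : 0 < ε) (hρ : ε ≤ ρ) (i : Fin 3) :
    HasCompactSupport (smearedField ε ρ i) := by
  refine HasCompactSupport.intro (isCompact_closedBall 0 ρ) fun y hy => ?_
  have hy : ρ < ‖y‖ := by simpa using hy
  rw [smearedField, smearedFactor_of_le hε (hρ.trans hy.le),
    smearedFactor_of_le (hε.trans_le hρ) hy.le]
  simp

lemma fderiv_smearedField (ε ρ : ℝ) (i j : Fin 3) (y : Space3) :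
    fderiv ℝ (smearedField ε ρ i) y (EuclideanSpace.single j 1)
      = (smearedFactor ε y - smearedFactor ρ y) * (if i = j then 1 else 0)
        + (2 * (ε ^ 3)⁻¹ * (kernelProfileDeriv (‖y‖ ^ 2 / ε ^ 2) / ε ^ 2)
          - 2 * (ρ ^ 3)⁻¹ * (kernelProfileDeriv (‖y‖ ^ 2 / ρ ^ 2) / ρ ^ 2)) * (y j * y i) := by
  have h1 : HasFDerivAt (fun y : Space3 => y i)
      (EuclideanSpace.proj (𝕜 := ℝ) i : Space3 →L[ℝ] ℝ) y :=
    (EuclideanSpace.proj (𝕜 := ℝ) i : Space3 →L[ℝ] ℝ).hasFDerivAt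
  have h := ((hasFDerivAt_smearedFactor ε y).sub (hasFDerivAt_smearedFactor ρ y)).mul h1
  have h' : HasFDerivAt (smearedField ε ρ i) _ y := h
  rw [h'.fderiv]
  simp [EuclideanSpace.inner_single_right, PiLp.single_apply]
  ring

/-- A radial field is curl-free. -/
lemma fderiv_smearedField_comm (ε ρ : ℝ) (i j : Fin 3) (y : Space3) :
    fderiv ℝ (smearedField ε ρ i) y (EuclideanSpace.single j 1)
      = fderiv ℝ (smearedField ε ρ j) y (EuclideanSpace.single i 1) := by
  rw [fderiv_smearedField, fderiv_smearedField, mul_comm (y j)]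
  simp only [eq_comm]

lemma sum_fderiv_smearedField {ε ρ : ℝ} (y : Space3) :
    ∑ j, fderiv ℝ (smearedField ε ρ j) y (EuclideanSpace.single j 1)
      = smearedCharge ε y - smearedCharge ρ y := by
  have hy : ‖y‖ ^ 2 = y 0 * y 0 + y 1 * y 1 + y 2 * y 2 := by
    rw [EuclideanSpace.norm_sq_eq]
    simp [Fin.sum_univ_three, sq]
  have key : ∀ ε, smearedCharge ε y = 3 * smearedFactor ε y
      + 2 * (ε ^ 3)⁻¹ * (kernelProfileDeriv (‖y‖ ^ 2 / ε ^ 2) / ε ^ 2) * ‖y‖ ^ 2 := by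
    intro ε
    rw [smearedCharge, ← chargeProfile_eq, smearedFactor]
    ring
  rw [key, key]
  simp only [fderiv_smearedField, Fin.sum_univ_three]
  simp only [if_true]
  linear_combination (-(2 * (ε ^ 3)⁻¹ * (kernelProfileDeriv (‖y‖ ^ 2 / ε ^ 2) / ε ^ 2)
          - 2 * (ρ ^ 3)⁻¹ * (kernelProfileDeriv (‖y‖ ^ 2 / ρ ^ 2) / ρ ^ 2))) * hy

lemma abs_smearedField_le {ε ρ : ℝ} (hε : 0 < ε) (hρ : 0 < ρ) (i : Fin 3) (y : Space3) :
    |smearedField ε ρ i y| ≤ 5 / 2 * (‖y‖ ^ 2)⁻¹ := by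
  rcases eq_or_ne y 0 with rfl | hy
  · simp [smearedField]
  have hy' : 0 < ‖y‖ := norm_pos_iff.2 hy
  -- Both factors lie in the same interval `[0, 5/2 |y|⁻³]`, so the bound is uniform in both scales.
  have h1 : |smearedFactor ε y - smearedFactor ρ y| ≤ 5 / 2 * (‖y‖ ^ 3)⁻¹ :=
    abs_sub_le_of_nonneg_of_le (smearedFactor_nonneg hε y) (smearedFactor_le hε hy)
      (smearedFactor_nonneg hρ y) (smearedFactor_le hρ hy)
  have h2 : |y i| ≤ ‖y‖ := by simpa using PiLp.norm_apply_le y i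
  rw [smearedField, abs_mul]
  calc _ ≤ 5 / 2 * (‖y‖ ^ 3)⁻¹ * ‖y‖ := by gcongr
    _ = _ := by field_simp

/-! ### Integration by parts against the vorticity -/

section Components

variable {u : Space3 → Space3}

lemma contDiff_component (hu : ContDiff ℝ ∞ u) (i : Fin 3) : ContDiff ℝ ∞ fun y => u y i :=
  (EuclideanSpace.proj (𝕜 := ℝ) i : Space3 →L[ℝ] ℝ).contDiff.comp hu

lemma fderiv_component (hu : ContDiff ℝ ∞ u) (i : Fin 3) (y v : Space3) :
    fderiv ℝ (fun y => u y i) y v = (fderiv ℝ u y v) i := by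
  have h := (EuclideanSpace.proj (𝕜 := ℝ) i : Space3 →L[ℝ] ℝ).hasFDerivAt.comp y
    ((hu.differentiable (by simp)) y).hasFDerivAt
  have h' : HasFDerivAt (fun y => u y i) _ y := h
  rw [h'.fderiv]
  rfl

lemma continuous_partialD (hu : ContDiff ℝ ∞ u) (j i : Fin 3) : Continuous (partialD u j i) := by
  have h : Continuous fun y => fderiv ℝ u y (EuclideanSpace.single j 1) :=
    (hu.continuous_fderiv (by simp)).clm_apply continuous_const
  exact (EuclideanSpace.proj (𝕜 := ℝ) i : Space3 →L[ℝ] ℝ).continuous.comp h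

lemma continuous_vorticity (hu : ContDiff ℝ ∞ u) : Continuous (vorticity u) := by
  have h := continuous_partialD hu
  have h3 : Continuous fun x => ![partialD u 1 2 x - partialD u 2 1 x,
     partialD u 2 0 x - partialD u 0 2 x, partialD u 0 1 x - partialD u 1 0 x] := by
    refine continuous_pi fun i => ?_
    fin_cases i
    · exact (h 1 2).sub (h 2 1)
    · exact (h 2 0).sub (h 0 2)
    · exact (h 0 1).sub (h 1 0)
  exact (PiLp.continuous_toLp 2 _).comp h3

lemma abs_partialD_sub_le (u : Space3 → Space3) (j i : Fin 3) (y : Space3) :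
    |partialD u j i y - partialD u i j y| ≤ ‖vorticity u y‖ := by
  have h := fun k => PiLp.norm_apply_le (vorticity u y) k
  have h0 := h 0
  have h1 := h 1
  have h2 := h 2
  simp only [vorticity, Real.norm_eq_abs, PiLp.toLp_apply, Matrix.cons_val] at h0 h1 h2
  fin_cases i <;> fin_cases j <;> simp only [Fin.zero_eta, Fin.mk_one, Fin.reduceFinMk, sub_self,
    abs_zero, norm_nonneg] <;> first | assumption | (rw [abs_sub_comm]; assumption)

/-- Integration by parts against a component of the smeared field. -/
lemma integral_component_mul_fderiv_smearedField (hu : ContDiff ℝ ∞ u) {ε ρ : ℝ} (hε : 0 < ε)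
    (hρ : ε ≤ ρ) (i j k : Fin 3) :
    ∫ y, u y i * fderiv ℝ (smearedField ε ρ k) y (EuclideanSpace.single j 1)
      = -∫ y, partialD u j i y * smearedField ε ρ k y := by
  have hK := contDiff_smearedField ε ρ k
  have hc := hasCompactSupport_smearedField hε hρ k
  have hf := contDiff_component hu i
  have h := integral_mul_fderiv_eq_neg_fderiv_mul_of_integrable (μ := (volume : Measure Space3))
    (f := fun y => u y i) (g := smearedField ε ρ k) (v := EuclideanSpace.single j 1) ?_ ?_ ?_
    (fun x _ => hf.differentiable (by simp) x) (fun x _ => hK.differentiable (by simp) x)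
  · simpa only [fderiv_component hu, partialD] using h
  · simp only [fderiv_component hu]
    exact ((continuous_partialD hu j i).mul hK.continuous).integrable_of_hasCompactSupport
      hc.mul_left
  · refine (hf.continuous.mul ?_).integrable_of_hasCompactSupport (hc.fderiv_apply (𝕜 := ℝ) _).mul_left
    exact (hK.continuous_fderiv (by simp)).clm_apply continuous_const
  · exact (hf.continuous.mul hK.continuous).integrable_of_hasCompactSupport hc.mul_left

lemma integrable_partialD_mul_smearedField (hu : ContDiff ℝ ∞ u) {ε ρ : ℝ} (hε : 0 < ε)
    (hρ : ε ≤ ρ) (i j k : Fin 3) :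
    Integrable fun y => partialD u j i y * smearedField ε ρ k y :=
  ((continuous_partialD hu j i).mul (contDiff_smearedField ε ρ k).continuous
    ).integrable_of_hasCompactSupport (hasCompactSupport_smearedField hε hρ k).mul_left

lemma integrable_component_mul_fderiv_smearedField (hu : ContDiff ℝ ∞ u) {ε ρ : ℝ} (hε : 0 < ε)
    (hρ : ε ≤ ρ) (i j k : Fin 3) :
    Integrable fun y => u y i * fderiv ℝ (smearedField ε ρ k) y (EuclideanSpace.single j 1) := by
  refine ((contDiff_component hu i).continuous.mul ?_).integrable_of_hasCompactSupport
    ((hasCompactSupport_smearedField hε hρ k).fderiv_apply (𝕜 := ℝ) _).mul_left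
  exact ((contDiff_smearedField ε ρ k).continuous_fderiv (by simp)).clm_apply continuous_const

/-- Smeared values of a divergence-free field at two scales differ by a Newtonian integral of its
vorticity. -/
lemma integral_component_mul_smearedCharge_sub (hu : ContDiff ℝ ∞ u) (hdiv : ∀ x, divg u x = 0)
    {ε ρ : ℝ} (hε : 0 < ε) (hρ : ε ≤ ρ) (i : Fin 3) :
    ∫ y, u y i * (smearedCharge ε y - smearedCharge ρ y)
      = -∫ y, ∑ j, (partialD u j i y - partialD u i j y) * smearedField ε ρ j y := by
  have h1 : ∫ y, u y i * (smearedCharge ε y - smearedCharge ρ y)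
      = -∑ j, ∫ y, partialD u j i y * smearedField ε ρ j y := by
    simp only [← sum_fderiv_smearedField, Finset.mul_sum]
    rw [integral_finsetSum _ fun j _ =>
      integrable_component_mul_fderiv_smearedField hu hε hρ i j j, ← Finset.sum_neg_distrib]
    exact Finset.sum_congr rfl fun j _ =>
      integral_component_mul_fderiv_smearedField hu hε hρ i j j
  -- Integrating by parts, swapping indices since `K` is curl-free, and integrating back turns `∂_i
  -- u_j K_j` into `∂_j u_j K_i`, whose sum vanishes with the divergence. Subtracting this zero
  -- leaves only vorticity entries.
  have h2 : ∑ j, ∫ y, partialD u i j y * smearedField ε ρ j y = 0 := by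
    calc ∑ j, ∫ y, partialD u i j y * smearedField ε ρ j y
        = ∑ j, ∫ y, partialD u j j y * smearedField ε ρ i y := by
          refine Finset.sum_congr rfl fun j _ => neg_injective ?_
          rw [← integral_component_mul_fderiv_smearedField hu hε hρ j i j,
            ← integral_component_mul_fderiv_smearedField hu hε hρ j j i]
          simp only [fderiv_smearedField_comm ε ρ i j]
      _ = ∫ y, divg u y * smearedField ε ρ i y := by
          rw [← integral_finsetSum _ fun j _ =>
            integrable_partialD_mul_smearedField hu hε hρ j j i]
          simp only [divg, Finset.sum_mul]
      _ = 0 := by simp [hdiv]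
  rw [h1, integral_finsetSum]
  · simp only [sub_mul]
    rw [← sub_zero (∑ j, ∫ y, partialD u j i y * smearedField ε ρ j y), ← h2,
      ← Finset.sum_sub_distrib]
    congr 1
    refine Finset.sum_congr rfl fun j _ => (integral_sub ?_ ?_).symm
    · exact integrable_partialD_mul_smearedField hu hε hρ i j j
    · exact integrable_partialD_mul_smearedField hu hε hρ j i j
  · intro j _
    simp only [sub_mul]
    exact (integrable_partialD_mul_smearedField hu hε hρ i j j).sub
      (integrable_partialD_mul_smearedField hu hε hρ j i j)

end Components

/-! ### Limits of the smeared values as the scale tends to `0` and to infinity -/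

lemma chargeProfile_nonneg (s : ℝ) : 0 ≤ chargeProfile s :=
  mul_nonneg (by norm_num) (le_max_left _ _)

lemma chargeProfile_le {s : ℝ} (hs : 0 ≤ s) : chargeProfile s ≤ 15 / 2 := by
  have : max 0 (1 - s) ≤ 1 := max_le zero_le_one (by linarith)
  unfold chargeProfile
  linarith

lemma continuous_chargeProfile : Continuous chargeProfile := by
  unfold chargeProfile
  fun_prop

lemma continuous_smearedCharge (ε : ℝ) : Continuous (smearedCharge ε) :=
  continuous_const.mul (continuous_chargeProfile.comp (by fun_prop))

lemma smearedCharge_of_le {ε : ℝ} (hε : 0 < ε) {y : Space3} (hy : ε ≤ ‖y‖) :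
    smearedCharge ε y = 0 := by
  have : 1 ≤ ‖y‖ ^ 2 / ε ^ 2 := by
    rw [← div_pow]
    exact one_le_pow₀ ((one_le_div hε).2 hy)
  simp [smearedCharge, chargeProfile, this]

lemma hasCompactSupport_smearedCharge {ε : ℝ} (hε : 0 < ε) : HasCompactSupport (smearedCharge ε) := by
  refine HasCompactSupport.intro (isCompact_closedBall 0 ε) fun y hy => ?_
  have hy : ε < ‖y‖ := by simpa using hy
  exact smearedCharge_of_le hε hy.le

/-- The total charge is divided out in the end, so its exact value is irrelevant. -/
lemma integral_smearedCharge_pos : 0 < ∫ y, smearedCharge 1 y := by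
  refine (continuous_smearedCharge 1).integral_pos_of_hasCompactSupport_nonneg_nonzero
    (hasCompactSupport_smearedCharge one_pos) (fun y => ?_) (x := 0) ?_
  · exact mul_nonneg (by norm_num) (chargeProfile_nonneg _)
  · simp [smearedCharge, chargeProfile]

/-- Smeared values tend to a multiple of the value as the scale tends to zero. -/
lemma tendsto_integral_mul_smearedCharge {g : Space3 → ℝ} (hg : Continuous g) :
    Tendsto (fun ε => ∫ y, g y * smearedCharge ε y) (𝓝[>] 0)
      (𝓝 (g 0 * ∫ y, smearedCharge 1 y)) := by
  have h1 : ∀ ε : ℝ, 0 < ε → ∫ y, g y * smearedCharge ε y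
      = ∫ w in Metric.closedBall (0 : Space3) 1, g (ε • w) * smearedCharge 1 w := by
    intro ε hε
    rw [setIntegral_eq_integral_of_forall_compl_eq_zero]
    · have h := Measure.integral_comp_smul (volume : Measure Space3)
        (fun y => g y * smearedCharge ε y) ε
      have h3 : ∫ y, g y * smearedCharge ε y
          = ε ^ 3 * ∫ w, g (ε • w) * smearedCharge ε (ε • w) := by
        rw [h, finrank_euclideanSpace_fin, abs_of_nonneg (by positivity), smul_eq_mul,
          mul_inv_cancel_left₀ (by positivity)]
      rw [h3, ← integral_const_mul]
      congr 1 with w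
      simp only [smearedCharge, norm_smul, Real.norm_eq_abs, abs_of_pos hε, mul_pow]
      field_simp
    · intro w hw
      have hw : 1 < ‖w‖ := by simpa using hw
      rw [smearedCharge_of_le one_pos hw.le, mul_zero]
  -- After `y = ε w` the scale occurs only inside `g`, and the integral over a fixed compact ball is
  -- continuous in `ε` even at `0`.
  have h2 : Continuous fun ε : ℝ =>
      ∫ w in Metric.closedBall (0 : Space3) 1, g (ε • w) * smearedCharge 1 w := by
    refine continuous_parametric_integral_of_continuous ?_ (isCompact_closedBall 0 1)
    exact (hg.comp (by fun_prop)).mul ((continuous_smearedCharge 1).comp continuous_snd)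
  have h3 := (h2.tendsto 0).mono_left (nhdsWithin_le_nhds (s := Set.Ioi 0))
  have h4 : ∫ w in Metric.closedBall (0 : Space3) 1, g ((0 : ℝ) • w) * smearedCharge 1 w
      = g 0 * ∫ y, smearedCharge 1 y := by
    simp only [zero_smul]
    rw [integral_const_mul, setIntegral_eq_integral_of_forall_compl_eq_zero]
    intro w hw
    have hw : 1 < ‖w‖ := by simpa using hw
    exact smearedCharge_of_le one_pos hw.le
  rw [h4] at h3
  refine h3.congr' ?_
  filter_upwards [self_mem_nhdsWithin] with ε hε using (h1 ε hε).symm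

/-- The charge of scale `ρ` is at most `15/2 ρ⁻³` and lives on the ball of radius `ρ`, so the mean
in `VanishesInMean` dominates. -/
lemma tendsto_integral_component_mul_smearedCharge_atTop {u : Space3 → Space3}
    (hu : Continuous u) (h : VanishesInMean u) (i : Fin 3) :
    Tendsto (fun ρ => ∫ y, u y i * smearedCharge ρ y) atTop (𝓝 0) := by
  have h0 := h.const_mul (15 / 2)
  rw [mul_zero] at h0
  refine squeeze_zero_norm' ?_ h0
  filter_upwards [eventually_gt_atTop 0] with ρ hρ
  have hint : IntegrableOn (fun y => ‖u y‖) (Metric.ball (0 : Space3) ρ) :=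
    (hu.norm.continuousOn.integrableOn_compact (isCompact_closedBall 0 ρ)).mono_set
      Metric.ball_subset_closedBall
  rw [← mul_assoc, ← integral_const_mul]
  rw [← setIntegral_eq_integral_of_forall_compl_eq_zero (s := Metric.ball (0 : Space3) ρ)]
  · refine norm_integral_le_of_norm_le (hint.const_mul _) (Eventually.of_forall fun y => ?_)
    have h1 : |u y i| ≤ ‖u y‖ := by simpa using PiLp.norm_apply_le (u y) i
    have h2 : |smearedCharge ρ y| ≤ 15 / 2 * (ρ ^ 3)⁻¹ := by
      rw [smearedCharge, abs_mul, abs_of_nonneg (chargeProfile_nonneg _),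
        abs_of_nonneg (by positivity), mul_comm]
      gcongr
      exact chargeProfile_le (by positivity)
    rw [Real.norm_eq_abs, abs_mul, mul_comm]
    gcongr
  · intro y hy
    have hy : ρ ≤ ‖y‖ := by simpa using hy
    rw [smearedCharge_of_le hρ hy, mul_zero]

lemma integrable_component_mul_smearedCharge {u : Space3 → Space3} (hu : ContDiff ℝ ∞ u)
    {ε : ℝ} (hε : 0 < ε) (i : Fin 3) : Integrable fun y => u y i * smearedCharge ε y :=
  ((contDiff_component hu i).continuous.mul (continuous_smearedCharge ε)
    ).integrable_of_hasCompactSupport (hasCompactSupport_smearedCharge hε).mul_left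

/-! ### Pointwise bound by the Newtonian potential of the vorticity -/

/-- The Newtonian kernel `|y|⁻²`. -/
noncomputable def newtonKernel (y : Space3) : ℝ≥0∞ := ENNReal.ofReal ((‖y‖ ^ 2)⁻¹)

lemma measurable_newtonKernel : Measurable newtonKernel := by
  unfold newtonKernel
  fun_prop

lemma enorm_integral_sum_le {u : Space3 → Space3} {ε ρ : ℝ} (hε : 0 < ε) (hρ : 0 < ρ)
    (i : Fin 3) :
    ‖∫ y, ∑ j, (partialD u j i y - partialD u i j y) * smearedField ε ρ j y‖ₑ
      ≤ ENNReal.ofReal (15 / 2) * ∫⁻ y, ‖vorticity u y‖ₑ * newtonKernel y := by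
  rw [← lintegral_const_mul' _ _ ENNReal.ofReal_ne_top]
  refine (enorm_integral_le_lintegral_enorm _).trans (lintegral_mono fun y => ?_)
  have h : |∑ j, (partialD u j i y - partialD u i j y) * smearedField ε ρ j y|
      ≤ 15 / 2 * (‖vorticity u y‖ * (‖y‖ ^ 2)⁻¹) := by
    calc _ ≤ ∑ j, |(partialD u j i y - partialD u i j y) * smearedField ε ρ j y| :=
          Finset.abs_sum_le_sum_abs _ _
      _ ≤ ∑ _j : Fin 3, ‖vorticity u y‖ * (5 / 2 * (‖y‖ ^ 2)⁻¹) := by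
          refine Finset.sum_le_sum fun j _ => ?_
          rw [abs_mul]
          exact mul_le_mul (abs_partialD_sub_le u j i y) (abs_smearedField_le hε hρ j y)
            (abs_nonneg _) (norm_nonneg _)
      _ = _ := by
          rw [Finset.sum_const, Finset.card_univ, Fintype.card_fin, nsmul_eq_mul]
          push_cast
          ring
  rw [Real.enorm_eq_ofReal_abs, newtonKernel, ← ofReal_norm, ← ENNReal.ofReal_mul (by positivity),
    ← ENNReal.ofReal_mul (by norm_num)]
  exact ENNReal.ofReal_le_ofReal h

/-- The bound on the right does not involve the scales, so it survives `ρ → ∞` and then `ε → 0`; the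
vorticity integral itself need not converge. -/
lemma enorm_component_zero_le {u : Space3 → Space3} (hu : ContDiff ℝ ∞ u)
    (hdiv : ∀ x, divg u x = 0) (hmean : VanishesInMean u) (i : Fin 3) :
    ‖u 0 i * ∫ y, smearedCharge 1 y‖ₑ
      ≤ ENNReal.ofReal (15 / 2) * ∫⁻ y, ‖vorticity u y‖ₑ * newtonKernel y := by
  have hstep : ∀ ε : ℝ, 0 < ε → ‖∫ y, u y i * smearedCharge ε y‖ₑ
      ≤ ENNReal.ofReal (15 / 2) * ∫⁻ y, ‖vorticity u y‖ₑ * newtonKernel y := by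
    intro ε hε
    have hlim := (tendsto_const_nhds (x := ∫ y, u y i * smearedCharge ε y)).sub
      (tendsto_integral_component_mul_smearedCharge_atTop hu.continuous hmean i)
    rw [sub_zero] at hlim
    refine le_of_tendsto hlim.enorm ?_
    filter_upwards [eventually_ge_atTop ε] with ρ hρ
    rw [← integral_sub (integrable_component_mul_smearedCharge hu hε i)
      (integrable_component_mul_smearedCharge hu (hε.trans_le hρ) i)]
    simp only [← mul_sub]
    rw [integral_component_mul_smearedCharge_sub hu hdiv hε hρ, enorm_neg]
    exact enorm_integral_sum_le hε (hε.trans_le hρ) i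
  refine le_of_tendsto
    (tendsto_integral_mul_smearedCharge (contDiff_component hu i).continuous).enorm ?_
  filter_upwards [self_mem_nhdsWithin] with ε hε using hstep ε hε

/-- The constant in the pointwise bound of a field by its vorticity. -/
noncomputable def vorticityConst : ℝ := 45 / 2 / ∫ y, smearedCharge 1 y

lemma enorm_zero_le {u : Space3 → Space3} (hu : ContDiff ℝ ∞ u)
    (hdiv : ∀ x, divg u x = 0) (hmean : VanishesInMean u) :
    ‖u 0‖ₑ ≤ ENNReal.ofReal vorticityConst * ∫⁻ y, ‖vorticity u y‖ₑ * newtonKernel y := by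
  set I := ∫⁻ y, ‖vorticity u y‖ₑ * newtonKernel y with hI
  have hc := integral_smearedCharge_pos
  have hvc : 0 < vorticityConst := div_pos (by norm_num) hc
  rcases eq_or_ne I ⊤ with hT | hT
  · rw [hT, ENNReal.mul_top (by simpa using hvc)]
    exact le_top
  have h : ∀ i, |u 0 i| * ∫ y, smearedCharge 1 y ≤ 15 / 2 * I.toReal := by
    intro i
    have h := enorm_component_zero_le hu hdiv hmean i
    rw [← hI, ← ENNReal.ofReal_toReal hT, ← ENNReal.ofReal_mul (by norm_num),
      Real.enorm_eq_ofReal_abs, ENNReal.ofReal_le_ofReal_iff (by positivity), abs_mul,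
      abs_of_pos hc] at h
    exact h
  -- Summing three components, each bounded with `15/2`, gives the `45/2` in `vorticityConst`.
  have hn : ‖u 0‖ ≤ |u 0 0| + |u 0 1| + |u 0 2| := by
    refine (pow_le_pow_iff_left₀ (norm_nonneg _) (by positivity) two_ne_zero).1 ?_
    rw [EuclideanSpace.norm_sq_eq, Fin.sum_univ_three]
    simp only [Real.norm_eq_abs]
    nlinarith [abs_nonneg (u 0 0), abs_nonneg (u 0 1), abs_nonneg (u 0 2),
      mul_nonneg (abs_nonneg (u 0 0)) (abs_nonneg (u 0 1)),
      mul_nonneg (abs_nonneg (u 0 0)) (abs_nonneg (u 0 2)),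
      mul_nonneg (abs_nonneg (u 0 1)) (abs_nonneg (u 0 2))]
  rw [← ENNReal.ofReal_toReal hT, ← ofReal_norm, ← ENNReal.ofReal_mul hvc.le]
  refine ENNReal.ofReal_le_ofReal ?_
  rw [vorticityConst, div_mul_eq_mul_div, le_div_iff₀ hc]
  nlinarith [h 0, h 1, h 2, mul_le_mul_of_nonneg_right hn hc.le]

section Translation

lemma partialD_comp_add_left (u : Space3 → Space3) (x : Space3) (j i : Fin 3) (y : Space3) :
    partialD (fun y => u (x + y)) j i y = partialD u j i (x + y) := by
  simp only [partialD]
  rw [fderiv_comp_add_left]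

/-- For `ρ ≥ ‖x‖` the ball of radius `ρ` about `x` lies in the one of radius `2ρ` about `0`, at the
cost of a factor `2³ = 8`. -/
lemma VanishesInMean.comp_add_left {u : Space3 → Space3} (hu : Continuous u)
    (h : VanishesInMean u) (x : Space3) : VanishesInMean fun y => u (x + y) := by
  have h2 : Tendsto (fun ρ : ℝ => 2 * ρ) atTop atTop :=
    tendsto_id.const_mul_atTop two_pos
  have h0 := (h.comp h2).const_mul 8
  rw [mul_zero] at h0
  refine squeeze_zero' (Eventually.of_forall fun ρ => ?_) ?_ h0
  swap
  · filter_upwards [eventually_gt_atTop 0, eventually_ge_atTop ‖x‖] with ρ hρ hx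
    have h1 : ∫ y in Metric.ball (0 : Space3) ρ, ‖u (x + y)‖
        = ∫ y in Metric.ball x ρ, ‖u y‖ := by
      have hm := (measurePreserving_add_left (volume : Measure Space3) x).setIntegral_preimage_emb
        (measurableEmbedding_addLeft x) (fun y => ‖u y‖) (Metric.ball x ρ)
      rw [← hm]
      congr 2
      ext y
      simp
    have h3 : ∫ y in Metric.ball x ρ, ‖u y‖ ≤ ∫ y in Metric.ball (0 : Space3) (2 * ρ), ‖u y‖ := by
      refine setIntegral_mono_set ?_ (Eventually.of_forall fun y => norm_nonneg _) ?_
      · exact (hu.norm.continuousOn.integrableOn_compact (isCompact_closedBall 0 (2 * ρ))).mono_set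
          Metric.ball_subset_closedBall
      · refine (Metric.ball_subset_ball' ?_).eventuallyLE
        rw [dist_zero_right]
        linarith
    rw [h1]
    simp only [Function.comp]
    calc _ ≤ (ρ ^ 3)⁻¹ * ∫ y in Metric.ball (0 : Space3) (2 * ρ), ‖u y‖ := by gcongr
      _ = _ := by rw [mul_pow, mul_inv]; ring
  · by_cases hρ : 0 ≤ ρ
    · exact mul_nonneg (by positivity) (integral_nonneg fun _ => norm_nonneg _)
    · rw [Metric.ball_eq_empty.2 (by linarith)]
      simp

/-- A divergence-free field vanishing at infinity in the mean is bounded by the Newtonian potential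
of its vorticity. -/
lemma enorm_le_lintegral_vorticity {u : Space3 → Space3} (hu : ContDiff ℝ ∞ u)
    (hdiv : ∀ x, divg u x = 0) (hmean : VanishesInMean u) (x : Space3) :
    ‖u x‖ₑ ≤ ENNReal.ofReal vorticityConst *
      ∫⁻ y, ‖vorticity u y‖ₑ * newtonKernel (y - x) := by
  have h := enorm_zero_le (u := fun y => u (x + y)) (hu.comp (by fun_prop))
    (fun y => by simpa only [divg, partialD_comp_add_left] using hdiv (x + y))
    (hmean.comp_add_left hu.continuous x)
  have hv : ∀ y, vorticity (fun y => u (x + y)) y = vorticity u (x + y) := fun y => by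
    simp only [vorticity, partialD_comp_add_left]
  simp only [add_zero, hv] at h
  rw [← lintegral_add_left_eq_self _ x]
  simpa only [add_sub_cancel_left] using h

end Translation

/-! ### Vorticity of axisymmetric fields without swirl -/

lemma exists_eq_cylPoint (x : Space3) : ∃ r θ z : ℝ, 0 ≤ r ∧ x = cylPoint r θ z := by
  refine ⟨‖(⟨x 0, x 1⟩ : ℂ)‖, Complex.arg ⟨x 0, x 1⟩, x 2, norm_nonneg _, ?_⟩
  ext i
  fin_cases i <;> simp [cylPoint, Complex.norm_mul_cos_arg, Complex.norm_mul_sin_arg]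

/-- This is `r u_θ = 0` in Cartesian form, which can be differentiated although nothing is known
about the smoothness of `ur` and `uz`. -/
lemma IsAxisymmetricNoSwirl.swirl_eq_zero {u : Space3 → Space3} (h : IsAxisymmetricNoSwirl u)
    (x : Space3) : x 0 * u x 1 - x 1 * u x 0 = 0 := by
  obtain ⟨ur, uz, h⟩ := h
  obtain ⟨r, θ, z, hr, rfl⟩ := exists_eq_cylPoint x
  rw [h r θ z hr]
  simp [cylPoint, eRad, eVert]
  ring

lemma cylPoint_eq (r θ z : ℝ) : cylPoint r θ z = (r * Real.cos θ) • EuclideanSpace.single 0 1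
    + (r * Real.sin θ) • EuclideanSpace.single 1 1 + z • EuclideanSpace.single 2 1 := by
  ext i
  fin_cases i <;> simp [cylPoint]

lemma hasDerivAt_cylPoint (r θ z : ℝ) : HasDerivAt (fun θ => cylPoint r θ z)
    ((r * -Real.sin θ) • EuclideanSpace.single 0 1 + (r * Real.cos θ) • EuclideanSpace.single 1 1)
    θ := by
  simp only [cylPoint_eq]
  exact ((((Real.hasDerivAt_cos θ).const_mul r).smul_const _).add
    (((Real.hasDerivAt_sin θ).const_mul r).smul_const _)).add_const _

/-- The infinitesimal form of rotation invariance. -/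
lemma IsAxisymmetricNoSwirl.rotation_deriv {u : Space3 → Space3} (h : IsAxisymmetricNoSwirl u)
    (hu : ContDiff ℝ ∞ u) (x : Space3) (i : Fin 3) :
    -x 1 * partialD u 0 i x + x 0 * partialD u 1 i x = ![-u x 1, u x 0, 0] i := by
  obtain ⟨ur, uz, h⟩ := h
  obtain ⟨r, θ, z, hr, rfl⟩ := exists_eq_cylPoint x
  have h1 := (((contDiff_component hu i).differentiable (by simp)
    (cylPoint r θ z)).hasFDerivAt.comp_hasDerivAt θ (hasDerivAt_cylPoint r θ z))
  have h2 : HasDerivAt (fun θ => u (cylPoint r θ z) i)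
      (![-(ur r z * Real.sin θ), ur r z * Real.cos θ, 0] i) θ := by
    simp only [h r _ z hr]
    fin_cases i
    · simpa [eRad, eVert] using (Real.hasDerivAt_cos θ).const_mul (ur r z)
    · simpa [eRad, eVert] using (Real.hasDerivAt_sin θ).const_mul (ur r z)
    · simpa [eRad, eVert] using hasDerivAt_const θ (uz r z)
  have h3 := h1.unique h2
  rw [map_add, map_smul, map_smul, fderiv_component hu, fderiv_component hu] at h3
  have h4 := h r θ z hr
  have e0 : cylPoint r θ z 0 = r * Real.cos θ := by simp [cylPoint]
  have e1 : cylPoint r θ z 1 = r * Real.sin θ := by simp [cylPoint]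
  rw [e0, e1, partialD, partialD]
  simp only [smul_eq_mul] at h3
  have h5 : (![-u (cylPoint r θ z) 1, u (cylPoint r θ z) 0, 0] : Fin 3 → ℝ)
      = ![-(ur r z * Real.sin θ), ur r z * Real.cos θ, 0] := by
    rw [h4]
    simp [eRad, eVert]
  rw [h5, ← h3]
  ring

lemma IsAxisymmetricNoSwirl.swirl_deriv {u : Space3 → Space3} (h : IsAxisymmetricNoSwirl u)
    (hu : ContDiff ℝ ∞ u) (x : Space3) (j : Fin 3) :
    (if j = 0 then 1 else 0) * u x 1 + x 0 * partialD u j 1 x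
      - ((if j = 1 then 1 else 0) * u x 0 + x 1 * partialD u j 0 x) = 0 := by
  have hp : ∀ i : Fin 3, HasFDerivAt (fun y : Space3 => y i)
      (EuclideanSpace.proj (𝕜 := ℝ) i : Space3 →L[ℝ] ℝ) x := fun i =>
    (EuclideanSpace.proj (𝕜 := ℝ) i : Space3 →L[ℝ] ℝ).hasFDerivAt
  have hf := fun i => ((contDiff_component hu i).differentiable (by simp) x).hasFDerivAt
  have h1 := ((hp 0).mul (hf 1)).sub ((hp 1).mul (hf 0))
  have h2 : HasFDerivAt (fun y : Space3 => y 0 * u y 1 - y 1 * u y 0) (0 : Space3 →L[ℝ] ℝ) x := by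
    simp only [h.swirl_eq_zero]
    exact hasFDerivAt_const (0 : ℝ) x
  have h3 := congrArg (fun L => L (EuclideanSpace.single j 1)) (h1.unique h2)
  simp [fderiv_component hu] at h3
  simp only [partialD, eq_comm (a := j), ite_mul, one_mul, zero_mul]
  linear_combination h3

lemma axisDist_sq (x : Space3) : axisDist x ^ 2 = x 0 ^ 2 + x 1 ^ 2 :=
  Real.sq_sqrt (by positivity)

lemma axisDist_nonneg (x : Space3) : 0 ≤ axisDist x := Real.sqrt_nonneg _

/-- The vorticity of an axisymmetric field without swirl is azimuthal. -/
lemma norm_vorticity_le {u : Space3 → Space3} (h : IsAxisymmetricNoSwirl u)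
    (hu : ContDiff ℝ ∞ u) {x : Space3} (hx : axisDist x ≠ 0) :
    ‖vorticity u x‖ ≤ axisDist x * |vortAngDivR u x| := by
  have hr : 0 < axisDist x := (axisDist_nonneg x).lt_of_ne' hx
  have hr2 := axisDist_sq x
  have d0 := h.swirl_deriv hu x 0
  have d1 := h.swirl_deriv hu x 1
  have d2 := h.swirl_deriv hu x 2
  have r0 := h.rotation_deriv hu x 0
  have r1 := h.rotation_deriv hu x 1
  have r2 := h.rotation_deriv hu x 2
  simp at d0 d1 d2 r0 r1 r2
  set a := partialD u 1 2 x - partialD u 2 1 x with ha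
  set b := partialD u 2 0 x - partialD u 0 2 x with hb
  set c := partialD u 0 1 x - partialD u 1 0 x with hc
  -- The radial component of the vorticity vanishes; `hcz` is the same for the vertical one.
  have hrad : a * x 0 + b * x 1 = 0 := by rw [ha, hb]; linear_combination r2 - d2
  have hc0 : x 0 * c = 0 := by rw [hc]; linear_combination d0 - r0
  have hc1 : x 1 * c = 0 := by rw [hc]; linear_combination d1 - r1
  have hcz : c = 0 := by
    have : axisDist x ^ 2 * c = 0 := by
      rw [hr2]; linear_combination x 0 * hc0 + x 1 * hc1
    exact (mul_eq_zero.1 this).resolve_left (by positivity)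
  have hw : vortAng u x = (axisDist x)⁻¹ * (b * x 0 - a * x 1) := by
    rw [vortAng, eAngField, inner_smul_right]
    simp [vorticity, PiLp.inner_apply, Fin.sum_univ_three, ← ha, ← hb]
    left
    ring
  have hn : ‖vorticity u x‖ ^ 2 = a ^ 2 + b ^ 2 := by
    rw [EuclideanSpace.norm_sq_eq, Fin.sum_univ_three]
    simp [vorticity, ← ha, ← hb, ← hc, hcz]
  rw [vortAngDivR, abs_div, abs_of_pos hr, mul_div_cancel₀ _ hx]
  refine (pow_le_pow_iff_left₀ (norm_nonneg _) (abs_nonneg _) two_ne_zero).1 ?_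
  rw [hn, sq_abs, hw, mul_pow, inv_pow, hr2]
  have hpos : 0 < x 0 ^ 2 + x 1 ^ 2 := hr2 ▸ (by positivity)
  rw [le_inv_mul_iff₀ hpos]
  -- Lagrange's identity: `(a² + b²) r² = (a x₀ + b x₁)² + (b x₀ - a x₁)²`, with the first square
  -- zero.
  nlinarith [hrad]

/-- The axis lies in the plane `x 0 = 0`, a proper subspace. -/
lemma ae_axisDist_ne_zero : ∀ᵐ x : Space3, axisDist x ≠ 0 := by
  set P : Submodule ℝ Space3 :=
    LinearMap.ker (EuclideanSpace.proj (𝕜 := ℝ) (0 : Fin 3) : Space3 →L[ℝ] ℝ).toLinearMap with hP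
  have hne : P ≠ ⊤ := by
    intro h
    have : EuclideanSpace.single (0 : Fin 3) (1 : ℝ) ∈ P := h ▸ Submodule.mem_top
    simp [hP] at this
  refine measure_mono_null (fun x hx => ?_)
    (Measure.addHaar_submodule (volume : Measure Space3) P hne)
  have hx : axisDist x = 0 := by simpa using hx
  have h2 := axisDist_sq x
  rw [hx] at h2
  have : x 0 = 0 := by nlinarith [sq_nonneg (x 0), sq_nonneg (x 1)]
  simpa [hP] using this

lemma measurable_vortAngDivR {u : Space3 → Space3} (hu : ContDiff ℝ ∞ u) :
    Measurable (vortAngDivR u) := by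
  have hd : Measurable axisDist := by unfold axisDist; fun_prop
  have he : Measurable eAngField := by
    unfold eAngField
    refine hd.inv.smul ?_
    have h3 : Continuous fun x : Space3 => ![-x 1, x 0, 0] := by
      refine continuous_pi fun i => ?_
      fin_cases i <;> simp <;> fun_prop
    exact ((PiLp.continuous_toLp 2 _).comp h3).measurable
  exact ((continuous_vorticity hu).measurable.inner he).div hd

/-! ### Young's inequality -/

/-- Jensen's inequality for integration against a kernel. -/
lemma lintegral_mul_rpow_le {α : Type*} [MeasurableSpace α] {μ : Measure α} {p : ℝ} (hp : 1 < p)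
    {f k : α → ℝ≥0∞} (hf : AEMeasurable f μ) (hk : AEMeasurable k μ) :
    (∫⁻ y, f y * k y ∂μ) ^ p ≤ (∫⁻ y, k y ∂μ) ^ (p - 1) * ∫⁻ y, f y ^ p * k y ∂μ := by
  have hpq := Real.HolderConjugate.conjExponent hp
  set q := p.conjExponent
  have hp0 : 0 < p := by linarith
  -- Hölder for the splitting `f k = (f k^{1/p}) k^{1/q}`; the final exponent is `p / q = p - 1`.
  have h := ENNReal.lintegral_mul_le_Lp_mul_Lq μ hpq (f := fun y => f y * k y ^ (1 / p))
    (g := fun y => k y ^ (1 / q)) (hf.mul (hk.pow_const _)) (hk.pow_const _)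
  have e1 : ∀ y, f y * k y ^ (1 / p) * k y ^ (1 / q) = f y * k y := fun y => by
    rw [mul_assoc, ← ENNReal.rpow_add_of_nonneg _ _ hpq.one_div_nonneg hpq.symm.one_div_nonneg,
      one_div, one_div, hpq.inv_add_inv_eq_one, ENNReal.rpow_one]
  have e2 : ∀ y, (f y * k y ^ (1 / p)) ^ p = f y ^ p * k y := fun y => by
    rw [ENNReal.mul_rpow_of_nonneg _ _ hp0.le, ← ENNReal.rpow_mul, one_div_mul_cancel hp0.ne',
      ENNReal.rpow_one]
  have e3 : ∀ y, (k y ^ (1 / q)) ^ q = k y := fun y => by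
    rw [← ENNReal.rpow_mul, one_div_mul_cancel hpq.symm.ne_zero, ENNReal.rpow_one]
  simp only [Pi.mul_apply, e1, e2, e3] at h
  calc (∫⁻ y, f y * k y ∂μ) ^ p
      ≤ ((∫⁻ y, f y ^ p * k y ∂μ) ^ (1 / p) * (∫⁻ y, k y ∂μ) ^ (1 / q)) ^ p := by gcongr
    _ = _ := by
      rw [ENNReal.mul_rpow_of_nonneg _ _ hp0.le, ← ENNReal.rpow_mul, ← ENNReal.rpow_mul,
        one_div_mul_cancel hp0.ne', ENNReal.rpow_one, mul_comm]
      congr 2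
      rw [one_div, ← hpq.one_sub_inv]
      field_simp

/-- Young's inequality `‖f ⋆ k‖_p ≤ ‖k‖_1 ‖f‖_p` for nonnegative functions. -/
lemma eLpNorm_lintegral_mul_sub_le {G : Type*} [AddCommGroup G] [MeasurableSpace G]
    [MeasurableAdd₂ G] [MeasurableNeg G] {μ : Measure G} [SFinite μ] [μ.IsAddLeftInvariant]
    [μ.IsNegInvariant] {p : ℝ} (hp : 1 < p) {f k : G → ℝ≥0∞} (hf : Measurable f)
    (hk : Measurable k) :
    eLpNorm (fun x => ∫⁻ y, f y * k (y - x) ∂μ) (ENNReal.ofReal p) μ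
      ≤ (∫⁻ y, k y ∂μ) * eLpNorm f (ENNReal.ofReal p) μ := by
  have hp0 : 0 < p := by linarith
  have hsub : ∀ x, ∫⁻ y, k (y - x) ∂μ = ∫⁻ y, k y ∂μ := fun x => by
    simp only [sub_eq_add_neg]
    exact lintegral_add_right_eq_self k (-x)
  have hsub' : ∀ y, ∫⁻ x, k (y - x) ∂μ = ∫⁻ x, k x ∂μ := fun y =>
    lintegral_sub_left_eq_self k y
  rw [eLpNorm_eq_lintegral_rpow_enorm_toReal (by simpa using hp0) ENNReal.ofReal_ne_top,
    eLpNorm_eq_lintegral_rpow_enorm_toReal (by simpa using hp0) ENNReal.ofReal_ne_top,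
    ENNReal.toReal_ofReal hp0.le]
  simp only [enorm_eq_self]
  set κ := ∫⁻ y, k y ∂μ with hκ
  have hmeas : Measurable (Function.uncurry fun x y => f y ^ p * k (y - x)) :=
    ((hf.comp measurable_snd).pow_const p).mul (hk.comp (measurable_snd.sub measurable_fst))
  -- Jensen against `k(y - x) dy`, then Tonelli: the kernel has mass `κ` in either variable.
  have key : ∫⁻ x, (∫⁻ y, f y * k (y - x) ∂μ) ^ p ∂μ ≤ κ ^ p * ∫⁻ y, f y ^ p ∂μ := by
    calc ∫⁻ x, (∫⁻ y, f y * k (y - x) ∂μ) ^ p ∂μ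
        ≤ ∫⁻ x, κ ^ (p - 1) * ∫⁻ y, f y ^ p * k (y - x) ∂μ ∂μ := by
          refine lintegral_mono fun x => ?_
          have h := lintegral_mul_rpow_le (μ := μ) hp (f := f) (k := fun y => k (y - x))
            hf.aemeasurable (hk.comp (measurable_id.sub_const x)).aemeasurable
          rwa [hsub] at h
      _ = κ ^ (p - 1) * ∫⁻ x, ∫⁻ y, f y ^ p * k (y - x) ∂μ ∂μ :=
          lintegral_const_mul _ hmeas.lintegral_prod_right'
      _ = κ ^ (p - 1) * ∫⁻ y, ∫⁻ x, f y ^ p * k (y - x) ∂μ ∂μ := by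
          rw [lintegral_lintegral_swap hmeas.aemeasurable]
      _ = κ ^ (p - 1) * ∫⁻ y, f y ^ p * κ ∂μ := by
          congr 2 with y
          rw [lintegral_const_mul _ (by fun_prop), hsub']
      _ = κ ^ (p - 1) * κ ^ (1 : ℝ) * ∫⁻ y, f y ^ p ∂μ := by
          rw [lintegral_mul_const _ (hf.pow_const p), ENNReal.rpow_one]
          ring
      _ = κ ^ p * ∫⁻ y, f y ^ p ∂μ := by
          rw [← ENNReal.rpow_add_of_nonneg _ _ (by linarith) zero_le_one, sub_add_cancel]
  calc _ ≤ (κ ^ p * ∫⁻ y, f y ^ p ∂μ) ^ (1 / p) := by gcongr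
    _ = _ := by
      rw [ENNReal.mul_rpow_of_nonneg _ _ (by positivity), ← ENNReal.rpow_mul,
        mul_one_div_cancel hp0.ne', ENNReal.rpow_one]

/-! ### The weighted kernel on the cylinder and the final estimate -/

/-- The Newtonian kernel truncated to the ball of radius `ρ`. -/
noncomputable def truncatedKernel (ρ : ℝ) : Space3 → ℝ≥0∞ :=
  (Metric.ball 0 ρ).indicator newtonKernel

/-- In polar coordinates the Jacobian `t²` cancels the singularity `t⁻²`. -/
lemma lintegral_truncatedKernel_lt_top (ρ : ℝ) : ∫⁻ y, truncatedKernel ρ y < ⊤ := by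
  have h : IntegrableOn (fun x : Space3 => (‖x‖ ^ 2)⁻¹) (Metric.ball 0 ρ) := by
    rw [integrableOn_fun_norm_addHaar (volume : Measure Space3) (f := fun t => (t ^ 2)⁻¹)]
    have h1 : IntegrableOn (fun _ : ℝ => (1 : ℝ)) (Set.Ioo 0 ρ) := by simp
    refine h1.congr_fun (fun t ht => ?_) measurableSet_Ioo
    have : t ≠ 0 := ht.1.ne'
    simp
    field_simp
  unfold truncatedKernel
  rw [lintegral_indicator measurableSet_ball]
  have h2 := h.2
  rw [hasFiniteIntegral_iff_ofReal (Eventually.of_forall fun x => by positivity)] at h2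
  exact h2

lemma norm_sq_eq_axisDist (x : Space3) : ‖x‖ ^ 2 = axisDist x ^ 2 + x 2 ^ 2 := by
  rw [EuclideanSpace.norm_sq_eq, Fin.sum_univ_three, axisDist_sq]
  simp

lemma axisDist_le_norm (x : Space3) : axisDist x ≤ ‖x‖ := by
  refine (pow_le_pow_iff_left₀ (axisDist_nonneg x) (norm_nonneg _) two_ne_zero).1 ?_
  rw [norm_sq_eq_axisDist]
  nlinarith [sq_nonneg (x 2)]

lemma norm_le_of_mem_solidCylinder {R : ℝ} {x : Space3} (hx : x ∈ solidCylinder R) :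
    ‖x‖ ≤ 2 * R := by
  obtain ⟨h1, h2⟩ := hx
  have h0 := axisDist_nonneg x
  refine (pow_le_pow_iff_left₀ (norm_nonneg _) (by linarith) two_ne_zero).1 ?_
  rw [norm_sq_eq_axisDist]
  have h3 : x 2 ^ 2 ≤ R ^ 2 := sq_le_sq' h2.1 h2.2
  nlinarith

lemma measurableSet_solidCylinder (R : ℝ) : MeasurableSet (solidCylinder R) := by
  have hd : Measurable axisDist := by unfold axisDist; fun_prop
  have h2 : Measurable fun x : Space3 => x 2 := by fun_prop
  exact (hd measurableSet_Iio).inter (h2 measurableSet_Icc)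

/-- On the cylinder the kernel `r |y - x|⁻²` is bounded, up to its truncation near the cylinder. -/
lemma axisDist_mul_newtonKernel_le {R : ℝ} (hR : 0 < R) {x : Space3} (hx : ‖x‖ ≤ 2 * R)
    (y : Space3) : ENNReal.ofReal (axisDist y) * newtonKernel (y - x)
      ≤ ENNReal.ofReal R⁻¹ + ENNReal.ofReal (4 * R) * truncatedKernel (6 * R) (y - x) := by
  have hy := axisDist_le_norm y
  -- If `|y| < 4R`, then `r < 4R` and `|y - x| < 6R`. Otherwise `|x| ≤ |y| / 2`, so `r |y - x|⁻² ≤ 4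
  -- / |y| ≤ 1 / R`.
  rcases lt_or_ge ‖y‖ (4 * R) with h | h
  · refine le_add_left ?_
    have hm : y - x ∈ Metric.ball (0 : Space3) (6 * R) := by
      rw [mem_ball_zero_iff]
      linarith [norm_sub_le y x]
    rw [truncatedKernel, Set.indicator_of_mem hm]
    gcongr
    linarith
  · refine le_add_right ?_
    rw [newtonKernel, ← ENNReal.ofReal_mul (axisDist_nonneg y)]
    refine ENNReal.ofReal_le_ofReal ?_
    have h1 : ‖y‖ / 2 ≤ ‖y - x‖ := by linarith [norm_sub_norm_le y x]
    have hy0 : 0 < ‖y‖ := by linarith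
    calc axisDist y * (‖y - x‖ ^ 2)⁻¹ ≤ ‖y‖ * ((‖y‖ / 2) ^ 2)⁻¹ := by gcongr
      _ = 4 / ‖y‖ := by field_simp; norm_num
      _ ≤ 4 / (4 * R) := by gcongr
      _ = R⁻¹ := by field_simp

/-- This bound, free of `p`, keeps the final constant dependent on `R` alone. -/
lemma measure_rpow_le_one_add {α : Type*} [MeasurableSpace α] (μ : Measure α) {p : ℝ} (hp : 1 ≤ p)
    (s : Set α) : μ s ^ (1 / p) ≤ 1 + μ s := by
  have hp' : 1 / p ≤ 1 := by rw [div_le_one (by linarith)]; exact hp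
  calc μ s ^ (1 / p) ≤ (1 + μ s) ^ (1 / p) := by gcongr; exact le_add_self
    _ ≤ (1 + μ s) ^ (1 : ℝ) := ENNReal.rpow_le_rpow_of_exponent_le le_self_add hp'
    _ = 1 + μ s := ENNReal.rpow_one _

/-- Pointwise bound on the cylinder of an axisymmetric field without swirl. -/
lemma enorm_le_of_mem_solidCylinder {R : ℝ} (hR : 0 < R) {u : Space3 → Space3}
    (hu : ContDiff ℝ ∞ u) (haxi : IsAxisymmetricNoSwirl u) (hdiv : ∀ x, divg u x = 0)
    (hmean : VanishesInMean u) {x : Space3} (hx : x ∈ solidCylinder R) :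
    ‖u x‖ₑ ≤ ENNReal.ofReal vorticityConst * (ENNReal.ofReal R⁻¹ * eLpNorm (vortAngDivR u) 1 volume
      + ENNReal.ofReal (4 * R) *
        ∫⁻ y, ‖vortAngDivR u y‖ₑ * truncatedKernel (6 * R) (y - x)) := by
  refine (enorm_le_lintegral_vorticity hu hdiv hmean x).trans ?_
  have hf := (measurable_vortAngDivR hu).enorm
  gcongr
  rw [eLpNorm_one_eq_lintegral_enorm, ← lintegral_const_mul _ hf,
    ← lintegral_const_mul' _ _ ENNReal.ofReal_ne_top, ← lintegral_add_left (hf.const_mul _)]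
  -- On the axis `vortAngDivR` has the default value `0`, so the comparison is made off this null
  -- set.
  refine lintegral_mono_ae ?_
  filter_upwards [ae_axisDist_ne_zero] with y hy
  have h1 : ‖vorticity u y‖ₑ ≤ ENNReal.ofReal (axisDist y) * ‖vortAngDivR u y‖ₑ := by
    rw [← ofReal_norm, Real.enorm_eq_ofReal_abs, ← ENNReal.ofReal_mul (axisDist_nonneg y)]
    exact ENNReal.ofReal_le_ofReal (norm_vorticity_le haxi hu hy)
  calc ‖vorticity u y‖ₑ * newtonKernel (y - x)
      ≤ ENNReal.ofReal (axisDist y) * ‖vortAngDivR u y‖ₑ * newtonKernel (y - x) := by gcongr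
    _ = ‖vortAngDivR u y‖ₑ * (ENNReal.ofReal (axisDist y) * newtonKernel (y - x)) := by ring
    _ ≤ ‖vortAngDivR u y‖ₑ * (ENNReal.ofReal R⁻¹
        + ENNReal.ofReal (4 * R) * truncatedKernel (6 * R) (y - x)) := by
      gcongr
      exact axisDist_mul_newtonKernel_le hR (norm_le_of_mem_solidCylinder hx) y
    _ = _ := by ring

theorem proposition3p1 (R : ℝ) (hR : 0 < R) :
    ∃ C : ℝ≥0, 0 < C ∧
      ∀ (p : ℝ≥0∞), 1 < p → p < ⊤ →
      ∀ (u : Space3 → Space3), ContDiff ℝ ∞ u → IsAxisymmetricNoSwirl u →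
        (∀ x, divg u x = 0) → VanishesInMean u →
        eLpNorm u p (volume.restrict (solidCylinder R)) ≤ C * normL1Lp (vortAngDivR u) p := by
  set c := ENNReal.ofReal vorticityConst with hc
  set V := (volume : Measure Space3) (solidCylinder R) with hV
  set κ := ∫⁻ y, truncatedKernel (6 * R) y with hκ
  have hVfin : V ≠ ⊤ := by
    refine ((measure_mono fun x hx => ?_).trans_lt
      (measure_closedBall_lt_top (x := (0 : Space3)) (r := 2 * R))).ne
    simpa using norm_le_of_mem_solidCylinder hx
  have hκfin : κ ≠ ⊤ := (lintegral_truncatedKernel_lt_top _).ne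
  -- The first summand is the far part, the second the near part; the `+ 1` makes positivity
  -- immediate.
  set D : ℝ≥0∞ := c * (ENNReal.ofReal R⁻¹ * (1 + V) + ENNReal.ofReal (4 * R) * κ) + 1 with hD
  have hDfin : D ≠ ⊤ := by
    refine ENNReal.add_ne_top.2 ⟨ENNReal.mul_ne_top ENNReal.ofReal_ne_top
      (ENNReal.add_ne_top.2 ⟨?_, ?_⟩), ENNReal.one_ne_top⟩
    · exact ENNReal.mul_ne_top ENNReal.ofReal_ne_top (by simp [hVfin])
    · exact ENNReal.mul_ne_top ENNReal.ofReal_ne_top hκfin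
  have hD0 : D ≠ 0 := by simp [hD]
  have hD1 : c * (ENNReal.ofReal R⁻¹ * (1 + V)) ≤ D := by
    refine le_add_right ?_
    gcongr
    exact le_self_add
  have hD2 : c * (ENNReal.ofReal (4 * R) * κ) ≤ D := by
    refine le_add_right ?_
    gcongr
    exact le_add_self
  refine ⟨D.toNNReal, ENNReal.toNNReal_pos hD0 hDfin, ?_⟩
  intro p hp hptop u hu haxi hdiv hmean
  rw [ENNReal.coe_toNNReal hDfin]
  obtain ⟨q, hq, rfl⟩ : ∃ q : ℝ, 1 < q ∧ p = ENNReal.ofReal q :=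
    ⟨p.toReal, by simpa using (ENNReal.toReal_lt_toReal ENNReal.one_ne_top hptop.ne).2 hp,
      (ENNReal.ofReal_toReal hptop.ne).symm⟩
  set f := vortAngDivR u with hf
  have hfm : Measurable fun y => ‖f y‖ₑ := (measurable_vortAngDivR hu).enorm
  have hkm : Measurable (truncatedKernel (6 * R)) :=
    measurable_newtonKernel.indicator measurableSet_ball
  set ν := (volume : Measure Space3).restrict (solidCylinder R)
  set A : ℝ≥0∞ := c * (ENNReal.ofReal R⁻¹ * eLpNorm f 1 volume)
  set B : Space3 → ℝ≥0∞ := fun x => ∫⁻ y, ‖f y‖ₑ * truncatedKernel (6 * R) (y - x)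
  have hBm : Measurable B := by
    have : Measurable (Function.uncurry fun x y : Space3 =>
        ‖f y‖ₑ * truncatedKernel (6 * R) (y - x)) :=
      (hfm.comp measurable_snd).mul (hkm.comp (measurable_snd.sub measurable_fst))
    exact this.lintegral_prod_right'
  have hq0 : ENNReal.ofReal q ≠ 0 := by simpa using (by linarith : 0 < q)
  set b : ℝ≥0 := (c * ENNReal.ofReal (4 * R)).toNNReal with hb
  have hbc : (b : ℝ≥0∞) = c * ENNReal.ofReal (4 * R) :=
    ENNReal.coe_toNNReal (ENNReal.mul_ne_top ENNReal.ofReal_ne_top ENNReal.ofReal_ne_top)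
  have h1 : eLpNorm u (ENNReal.ofReal q) ν
      ≤ eLpNorm ((fun _ => A) + fun x => (b : ℝ≥0∞) * B x) (ENNReal.ofReal q) ν := by
    refine eLpNorm_mono_enorm_ae ?_
    filter_upwards [ae_restrict_mem (measurableSet_solidCylinder R)] with x hx
    rw [enorm_eq_self]
    refine (enorm_le_of_mem_solidCylinder hR hu haxi hdiv hmean hx).trans_eq ?_
    rw [Pi.add_apply, hbc, mul_add, mul_assoc]
  have h2 : eLpNorm (fun _ : Space3 => A) (ENNReal.ofReal q) ν ≤ A * (1 + V) := by
    rw [eLpNorm_const' _ hq0 ENNReal.ofReal_ne_top, enorm_eq_self, Measure.restrict_apply_univ,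
      ENNReal.toReal_ofReal (by linarith)]
    gcongr
    exact measure_rpow_le_one_add _ hq.le _
  have h3 : eLpNorm (fun x => (b : ℝ≥0∞) * B x) (ENNReal.ofReal q) ν
      ≤ b * (κ * eLpNorm f (ENNReal.ofReal q) volume) := by
    refine (eLpNorm_le_nnreal_smul_eLpNorm_of_ae_le_mul' (g := B) (c := b)
      (Eventually.of_forall fun x => by simp) _).trans ?_
    rw [ENNReal.smul_def, smul_eq_mul]
    gcongr
    -- Young's inequality needs a translation-invariant measure, so the cylinder is enlarged to the
    -- whole space.
    refine (eLpNorm_mono_measure _ Measure.restrict_le_self).trans ?_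
    refine (eLpNorm_lintegral_mul_sub_le hq hfm hkm).trans_eq ?_
    rw [eLpNorm_enorm]
  calc eLpNorm u (ENNReal.ofReal q) ν ≤ A * (1 + V) + b * (κ * eLpNorm f (ENNReal.ofReal q) volume) :=
        h1.trans ((eLpNorm_add_le aestronglyMeasurable_const
          (hBm.const_mul _).aestronglyMeasurable (by simpa using hq.le)).trans (add_le_add h2 h3))
    _ = c * (ENNReal.ofReal R⁻¹ * (1 + V)) * eLpNorm f 1 volume
        + c * (ENNReal.ofReal (4 * R) * κ) * eLpNorm f (ENNReal.ofReal q) volume := by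
      rw [hbc]; ring
    _ ≤ D * eLpNorm f 1 volume + D * eLpNorm f (ENNReal.ofReal q) volume := by
      exact add_le_add (mul_le_mul_left hD1 _) (mul_le_mul_left hD2 _)
    _ = D * normL1Lp f (ENNReal.ofReal q) := by rw [normL1Lp, mul_add]
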